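/- For a finite signed Borel measure $\mu$ on $\mathbb{R}$ let $-\Delta+\mu$ denote the self-adjoint operator in the complex Hilbert space $L^2(\mathbb{R})$ associated, in the sense of Kato's first representation theorem, with the closed lower semibounded form $$a_\mu(f,g)=\int_{\mathbb{R}} f'(x)\overline{g'(x)}\,dx+\int_{\mathbb{R}} f\,\overline{g}\,d\mu,\qquad D(a_\mu)=H^1(\mathbb{R}),$$ where functions in $H^1(\mathbb{R})$ are identified with their continuous representatives. That is, $f\in D(-\Delta+\mu)$ and $(-\Delta+\mu)f=h$ if and only if $f\in H^1(\mathbb{R})$, $h\in L^2(\mathbb{R})$ and $\langle h,g\rangle=a_\mu(f,g)$ for all $g\in H^1(\mathbb{R})$. Let $x_1<x_2<\dots<x_n$ and $\alpha_1,\dots,\alpha_n$ be real numbers, and let $k\in\{1,\dots,n\}$ be such that $\alpha_k<0$. Put $d_k^-=x_k-x_{k-1}$ (with $d_k^-=\infty$ if $k=1$) and $d_k^+=x_{k+1}-x_k$ (with $d_k^+=\infty$ if $k=n$). If $$\frac{1}{d_k^-}+\frac{1}{d_k^+}<-\alpha_k$$ (where $1/\infty=0$), then the operator $-\Delta+\sum_{j=1}^n\alpha_j\delta_{x_j}$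 has at least one negative eigenvalue. -/

import Mathlib

open MeasureTheory
open scoped ContDiff ENNReal

noncomputable section

namespace DeltaSchrodinger

/-- The Hilbert space `L²(ℝ)` of complex-valued square-integrable functions. -/
abbrev L2 : Type := Lp ℂ 2 (volume : Measure ℝ)

/-- `g` is the weak derivative of `f` on `ℝ`. -/
def HasWeakDeriv (f g : ℝ → ℂ) : Prop :=
  ∀ φ : ℝ → ℝ, ContDiff ℝ ∞ φ → HasCompactSupport φ →
    ∫ x, deriv φ x • f x = -∫ x, φ x • g x

lemma locallyIntegrable (f : L2) : LocallyIntegrable (f : ℝ → ℂ) :=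
  (Lp.memLp f).locallyIntegrable (by norm_num)

lemma intervalIntegrable {g : ℝ → ℂ} (hg : LocallyIntegrable g) (a b : ℝ) :
    IntervalIntegrable g volume a b :=
  (hg.integrableOn_isCompact isCompact_uIcc).intervalIntegrable

lemma integrable_test {f : ℝ → ℂ} (hf : LocallyIntegrable f) {φ : ℝ → ℝ} (hφ : ContDiff ℝ ∞ φ)
    (hc : HasCompactSupport φ) : Integrable fun x => φ x • f x :=
  hf.integrable_smul_left_of_hasCompactSupport hφ.continuous hc

lemma integrable_deriv_test {f : ℝ → ℂ} (hf : LocallyIntegrable f) {φ : ℝ → ℝ}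
    (hφ : ContDiff ℝ ∞ φ) (hc : HasCompactSupport φ) : Integrable fun x => deriv φ x • f x :=
  hf.integrable_smul_left_of_hasCompactSupport (hφ.continuous_deriv (by simp)) hc.deriv

lemma HasWeakDeriv.congr {f f' g g' : ℝ → ℂ} (h : HasWeakDeriv f g) (hf : f =ᵐ[volume] f')
    (hg : g =ᵐ[volume] g') : HasWeakDeriv f' g' := by
  intro φ h1 h2
  have e1 : ∫ x, deriv φ x • f' x = ∫ x, deriv φ x • f x :=
    integral_congr_ae (hf.mono fun x hx => by simp [hx])
  have e2 : ∫ x, φ x • g' x = ∫ x, φ x • g x :=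
    integral_congr_ae (hg.mono fun x hx => by simp [hx])
  rw [e1, e2, h φ h1 h2]

lemma HasWeakDeriv.add {f f' g g' : ℝ → ℂ} (hf : LocallyIntegrable f) (hf' : LocallyIntegrable f')
    (hg : LocallyIntegrable g) (hg' : LocallyIntegrable g')
    (h : HasWeakDeriv f g) (h' : HasWeakDeriv f' g') : HasWeakDeriv (f + f') (g + g') := by
  intro φ h1 h2
  simp only [Pi.add_apply, smul_add]
  rw [integral_add (integrable_deriv_test hf h1 h2) (integrable_deriv_test hf' h1 h2),
    integral_add (integrable_test hg h1 h2) (integrable_test hg' h1 h2), h φ h1 h2, h' φ h1 h2]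
  ring

lemma HasWeakDeriv.smul {f g : ℝ → ℂ} (c : ℂ) (h : HasWeakDeriv f g) :
    HasWeakDeriv (c • f) (c • g) := by
  intro φ h1 h2
  simp only [Pi.smul_apply, smul_comm _ c]
  rw [integral_smul, integral_smul, h φ h1 h2, smul_neg]

lemma HasWeakDeriv.unique {f g g' : ℝ → ℂ} (hg : LocallyIntegrable g)
    (hg' : LocallyIntegrable g') (h : HasWeakDeriv f g) (h' : HasWeakDeriv f g') :
    g =ᵐ[volume] g' :=
  ae_eq_of_integral_contDiff_smul_eq hg hg' fun φ h1 h2 =>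
    neg_injective ((h φ h1 h2).symm.trans (h' φ h1 h2))

/-- The Sobolev space `H¹(ℝ)`: the elements of `L²(ℝ)` with a weak derivative in `L²(ℝ)`. -/
def H1 : Submodule ℂ L2 where
  carrier := {f | ∃ g : L2, HasWeakDeriv f g}
  zero_mem' := ⟨0, HasWeakDeriv.congr (f := 0) (g := 0) (fun φ _ _ => by simp)
    (Lp.coeFn_zero ℂ 2 volume).symm (Lp.coeFn_zero ℂ 2 volume).symm⟩
  add_mem' := by
    rintro f f' ⟨g, h⟩ ⟨g', h'⟩
    exact ⟨g + g', (h.add (locallyIntegrable f) (locallyIntegrable f') (locallyIntegrable g)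
      (locallyIntegrable g') h').congr (Lp.coeFn_add f f').symm (Lp.coeFn_add g g').symm⟩
  smul_mem' := by
    rintro c f ⟨g, h⟩
    exact ⟨c • g, (h.smul c).congr (Lp.coeFn_smul c f).symm (Lp.coeFn_smul c g).symm⟩

/-- The weak derivative of an `H¹` function, as an element of `L²(ℝ)`. -/
def weakDeriv (f : H1) : L2 := f.2.choose

lemma hasWeakDeriv (f : H1) : HasWeakDeriv (f : L2) (weakDeriv f) := f.2.choose_spec

lemma weakDeriv_eq {f : H1} {g : L2} (h : HasWeakDeriv (f : L2) g) : weakDeriv f = g :=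
  Lp.ext ((hasWeakDeriv f).unique (locallyIntegrable _) (locallyIntegrable _) h)

lemma weakDeriv_add (f g : H1) : weakDeriv (f + g) = weakDeriv f + weakDeriv g :=
  weakDeriv_eq (((hasWeakDeriv f).add (locallyIntegrable _) (locallyIntegrable _)
    (locallyIntegrable _) (locallyIntegrable _) (hasWeakDeriv g)).congr
    (Lp.coeFn_add (f : L2) (g : L2)).symm (Lp.coeFn_add _ _).symm)

lemma weakDeriv_smul (c : ℂ) (f : H1) : weakDeriv (c • f) = c • weakDeriv f :=
  weakDeriv_eq (((hasWeakDeriv f).smul c).congr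
    (Lp.coeFn_smul c (f : L2)).symm (Lp.coeFn_smul _ _).symm)

/-- A locally integrable function is the weak derivative of its integral function. -/
lemma hasWeakDeriv_integral {g : ℝ → ℂ} (hg : LocallyIntegrable g) :
    HasWeakDeriv (fun x => ∫ t in (0 : ℝ)..x, g t) g := by
  intro φ h1 h2
  have hii : ∀ a b, IntervalIntegrable g volume a b := fun a b => intervalIntegrable hg a b
  obtain ⟨R, hR⟩ := h2.isCompact.isBounded.subset_closedBall (0 : ℝ)
  have hφR : ∀ x, x ∉ Set.Icc (-R) R → φ x = 0 ∧ deriv φ x = 0 := by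
    intro x hx
    have hx' : x ∉ tsupport φ := fun h => hx (by
      have := hR h
      rw [Real.closedBall_eq_Icc] at this
      simpa using this)
    exact ⟨image_eq_zero_of_notMem_tsupport hx',
      image_eq_zero_of_notMem_tsupport fun h => hx' (tsupport_deriv_subset h)⟩
  have h1' : ContDiff ℝ 1 φ := h1.of_le (by simp)
  have hd0 : ∫ x, deriv φ x = 0 := by
    have e1 := HasCompactSupport.integral_Ioi_deriv_eq h1' h2 0
    have e2 := HasCompactSupport.integral_Iic_deriv_eq h1' h2 0
    have hint : Integrable (deriv φ) :=
      (h1.continuous_deriv (by simp)).integrable_of_hasCompactSupport h2.deriv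
    rw [← intervalIntegral.integral_Iic_add_Ioi hint.integrableOn hint.integrableOn, e1, e2]
    ring
  set G : ℝ → ℂ := (Set.Icc (-R) R).indicator g with hG
  have hGi : Integrable G := (integrable_indicator_iff measurableSet_Icc).2
    (hg.integrableOn_isCompact isCompact_Icc)
  set C : ℂ := ∫ t in (0 : ℝ)..(-R), g t
  have key : ∀ x, deriv φ x • ∫ t in (0 : ℝ)..x, g t =
      deriv φ x • C + ∫ t, (Set.Iic x).indicator (fun t => deriv φ x • G t) t := by
    intro x
    by_cases hx : x ∈ Set.Icc (-R) R
    · rw [integral_indicator measurableSet_Iic, integral_smul, ← smul_add]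
      congr 1
      rw [hG, setIntegral_indicator measurableSet_Icc,
        ← intervalIntegral.integral_add_adjacent_intervals (hii 0 (-R)) (hii (-R) x)]
      congr 1
      rw [intervalIntegral.integral_of_le hx.1, ← integral_Icc_eq_integral_Ioc]
      congr 2
      ext t
      simp only [Set.mem_Icc, Set.mem_inter_iff, Set.mem_Iic]
      constructor
      · rintro ⟨a, b⟩
        exact ⟨b, a, b.trans hx.2⟩
      · rintro ⟨a, b, c⟩
        exact ⟨b, a⟩
    · simp [(hφR x hx).2]
  have hdi : Integrable (deriv φ) :=
    (h1.continuous_deriv (by simp)).integrable_of_hasCompactSupport h2.deriv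
  have hprod : Integrable (Function.uncurry fun x t : ℝ =>
      (Set.Iic x).indicator (fun t => deriv φ x • G t) t) (volume.prod volume) := by
    have e := (hdi.smul_prod hGi).indicator
      (measurableSet_le measurable_snd measurable_fst : MeasurableSet {p : ℝ × ℝ | p.2 ≤ p.1})
    refine e.congr (Filter.Eventually.of_forall fun p => ?_)
    simp [Set.indicator, Function.uncurry]
  calc ∫ x, deriv φ x • ∫ t in (0 : ℝ)..x, g t
      = ∫ x, (deriv φ x • C + ∫ t, (Set.Iic x).indicator (fun t => deriv φ x • G t) t) :=
        integral_congr_ae (Filter.Eventually.of_forall key)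
    _ = ∫ x, ∫ t, (Set.Iic x).indicator (fun t => deriv φ x • G t) t := by
        have e := integral_add (hdi.smul_const C) hprod.integral_prod_left
        simp only [Function.uncurry] at e
        rw [e, integral_smul_const, hd0, zero_smul, zero_add]
    _ = ∫ t, ∫ x, (Set.Iic x).indicator (fun t => deriv φ x • G t) t :=
        integral_integral_swap hprod
    _ = ∫ t, -(φ t • g t) := by
        refine integral_congr_ae (Filter.Eventually.of_forall fun t => ?_)
        have e : (fun x => (Set.Iic x).indicator (fun t => deriv φ x • G t) t) =
            (Set.Ici t).indicator fun x => deriv φ x • G t := by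
          ext x
          simp [Set.indicator]
        simp only [e]
        rw [integral_indicator measurableSet_Ici, integral_smul_const,
          integral_Ici_eq_integral_Ioi, HasCompactSupport.integral_Ioi_deriv_eq h1' h2]
        by_cases ht : t ∈ Set.Icc (-R) R
        · simp [hG, ht]
        · simp [(hφR t ht).1]
    _ = -∫ x, φ x • g x := integral_neg _

/-- A locally integrable function with vanishing weak derivative is a.e. constant. -/
lemma ae_const_of_weakDeriv_zero {w : ℝ → ℂ} (hw : LocallyIntegrable w)
    (h : HasWeakDeriv w 0) : ∃ c : ℂ, w =ᵐ[volume] fun _ => c := by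
  let b : ContDiffBump (0 : ℝ) := default
  set ρ : ℝ → ℝ := b.normed volume
  have hρ : ContDiff ℝ ∞ ρ := b.contDiff_normed
  have hρc : HasCompactSupport ρ := b.hasCompactSupport_normed
  have hρ1 : ∫ x, ρ x = 1 := b.integral_normed
  refine ⟨∫ x, ρ x • w x, ?_⟩
  refine ae_eq_of_integral_contDiff_smul_eq hw (continuous_const.locallyIntegrable) ?_
  intro ψ hψ hψc
  rw [integral_smul_const]
  set I : ℝ := ∫ x, ψ x with hI
  -- the primitive of a test function with zero mean is a test function
  set θ : ℝ → ℝ := fun x => ψ x - I * ρ x with hθ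
  have hθs : ContDiff ℝ ∞ θ := hψ.sub (contDiff_const.mul hρ)
  have hθc : HasCompactSupport θ := hψc.sub (hρc.mul_left)
  have hθi : Integrable θ := hθs.continuous.integrable_of_hasCompactSupport hθc
  have hθ0 : ∫ x, θ x = 0 := by
    rw [hθ, integral_sub (hψ.continuous.integrable_of_hasCompactSupport hψc)
      ((hρ.continuous.integrable_of_hasCompactSupport hρc).const_mul I), integral_const_mul, hρ1]
    simp [hI]
  obtain ⟨R, hR⟩ := hθc.isCompact.isBounded.subset_closedBall (0 : ℝ)
  have hθR : ∀ x, x ∉ Set.Icc (-R) R → θ x = 0 := by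
    intro x hx
    refine image_eq_zero_of_notMem_tsupport fun h => hx ?_
    have := hR h
    rw [Real.closedBall_eq_Icc] at this
    simpa using this
  set Φ : ℝ → ℝ := fun x => ∫ t in (-R)..x, θ t with hΦ
  have hder : ∀ x, HasDerivAt Φ (θ x) x := fun x =>
    intervalIntegral.integral_hasDerivAt_right (hθs.continuous.intervalIntegrable _ _)
      (hθs.continuous.stronglyMeasurableAtFilter _ _) hθs.continuous.continuousAt
  have hderiv : deriv Φ = θ := funext fun x => (hder x).deriv
  have hΦs : ContDiff ℝ ∞ Φ :=
    contDiff_infty_iff_deriv.2 ⟨fun x => (hder x).differentiableAt, hderiv ▸ hθs⟩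
  have hΦc : HasCompactSupport Φ := by
    refine HasCompactSupport.intro (isCompact_Icc (a := -R) (b := R)) fun x hx => ?_
    rw [Set.mem_Icc, not_and_or, not_le, not_le] at hx
    rcases lt_or_ge x (-R) with hx' | hx'
    · rw [hΦ]
      simp only
      rw [intervalIntegral.integral_congr_ae (g := fun _ => 0)]
      · simp
      · filter_upwards [compl_mem_ae_iff.2 (measure_singleton (-R))] with t ht ht'
        rw [Set.uIoc_of_ge hx'.le] at ht'
        exact hθR t fun hh => ht (le_antisymm ht'.2 hh.1)
    · have hx2 : R < x := hx.resolve_left (not_lt.2 hx')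
      rw [hΦ]
      simp only
      rw [intervalIntegral.integral_of_le hx', ← integral_Icc_eq_integral_Ioc,
        setIntegral_eq_integral_of_forall_compl_eq_zero, hθ0]
      exact fun t ht => hθR t fun hh => ht ⟨hh.1, hh.2.trans hx2.le⟩
  have := h Φ hΦs hΦc
  rw [hderiv] at this
  simp only [Pi.zero_apply, smul_zero, integral_zero, neg_zero, hθ, sub_smul, mul_smul] at this
  have e := integral_sub (integrable_test hw hψ hψc) ((integrable_test hw hρ hρc).smul I)
  simp only [Pi.smul_apply] at e
  rw [e, integral_smul, sub_eq_zero] at this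
  exact this

/-- An `H¹` function is a.e. equal to an integral function of its weak derivative. -/
lemma exists_rep (f : H1) : ∃ c : ℂ,
    (f : L2) =ᵐ[volume] fun x => c + ∫ t in (0 : ℝ)..x, (weakDeriv f : ℝ → ℂ) t := by
  have hg := locallyIntegrable (weakDeriv f)
  have hu : Continuous fun x => ∫ t in (0 : ℝ)..x, (weakDeriv f : ℝ → ℂ) t :=
    intervalIntegral.continuous_primitive (fun a b => intervalIntegrable hg a b) 0
  have h1 := hasWeakDeriv_integral hg
  have h2 := (hasWeakDeriv f).add (locallyIntegrable _) (hu.locallyIntegrable.smul (-1 : ℂ)) hg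
    (hg.smul (-1 : ℂ)) (h1.smul (-1))
  have e : (weakDeriv f : ℝ → ℂ) + (-1 : ℂ) • (weakDeriv f : ℝ → ℂ) = 0 := by
    simp
  rw [e] at h2
  obtain ⟨c, hc⟩ := ae_const_of_weakDeriv_zero
    ((locallyIntegrable (f : L2)).add (hu.locallyIntegrable.smul (-1 : ℂ))) h2
  refine ⟨c, hc.mono fun x hx => ?_⟩
  simp only [Pi.add_apply, Pi.smul_apply, smul_eq_mul] at hx
  rw [← hx]
  ring

lemma exists_continuous (f : H1) : ∃ u : ℝ → ℂ, Continuous u ∧ (f : L2) =ᵐ[volume] u := by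
  obtain ⟨c, hc⟩ := exists_rep f
  exact ⟨_, continuous_const.add (intervalIntegral.continuous_primitive
    (fun a b => intervalIntegrable (locallyIntegrable (weakDeriv f)) a b) 0), hc⟩

/-- The continuous representative of an `H¹` function; it gives the function its point values. -/
def rep (f : H1) : ℝ → ℂ := (exists_continuous f).choose

lemma continuous_rep (f : H1) : Continuous (rep f) := (exists_continuous f).choose_spec.1

lemma coe_ae_eq_rep (f : H1) : (f : L2) =ᵐ[volume] rep f := (exists_continuous f).choose_spec.2

lemma rep_eq {f : H1} {u : ℝ → ℂ} (hu : Continuous u) (h : (f : L2) =ᵐ[volume] u) : rep f = u :=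
  ((continuous_rep f).ae_eq_iff_eq volume hu).1 ((coe_ae_eq_rep f).symm.trans h)

lemma rep_add (f g : H1) : rep (f + g) = rep f + rep g :=
  rep_eq ((continuous_rep f).add (continuous_rep g))
    ((Lp.coeFn_add (f : L2) (g : L2)).trans ((coe_ae_eq_rep f).add (coe_ae_eq_rep g)))

lemma rep_smul (c : ℂ) (f : H1) : rep (c • f) = c • rep f :=
  rep_eq ((continuous_rep f).const_smul c)
    ((Lp.coeFn_smul c (f : L2)).trans ((coe_ae_eq_rep f).const_smul c))

lemma rep_bounded (f : H1) : ∃ C : ℝ, ∀ x, ‖rep f x‖ ≤ C := by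
  obtain ⟨c, hc⟩ := exists_rep f
  set g : ℝ → ℂ := (weakDeriv f : ℝ → ℂ)
  have hg : LocallyIntegrable g := locallyIntegrable (weakDeriv f)
  have hii : ∀ a b, IntervalIntegrable g volume a b := fun a b => intervalIntegrable hg a b
  have hr : rep f = fun x => c + ∫ t in (0 : ℝ)..x, g t :=
    rep_eq (continuous_const.add (intervalIntegral.continuous_primitive hii 0)) hc
  have unit_bound : ∀ {v : ℝ → ℂ} (_ : MemLp v 2 volume) (x : ℝ),
      ∫ t in Set.Icc x (x + 1), ‖v t‖ ≤ 1 + ∫ t, ‖v t‖ ^ 2 := by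
    intro v hv x
    have hv2 : Integrable fun t => ‖v t‖ ^ 2 := hv.integrable_norm_pow (by norm_num)
    have hv1 : IntegrableOn v (Set.Icc x (x + 1)) :=
      (hv.locallyIntegrable (by norm_num)).integrableOn_isCompact isCompact_Icc
    calc ∫ t in Set.Icc x (x + 1), ‖v t‖
        ≤ ∫ t in Set.Icc x (x + 1), (1 + ‖v t‖ ^ 2) := by
          refine integral_mono hv1.norm ((integrable_const _).add hv2.integrableOn) fun t => ?_
          simp only
          nlinarith [sq_nonneg (‖v t‖ - 1), norm_nonneg (v t)]
      _ = 1 + ∫ t in Set.Icc x (x + 1), ‖v t‖ ^ 2 := by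
          rw [integral_add (integrable_const _) hv2.integrableOn]
          simp
      _ ≤ 1 + ∫ t, ‖v t‖ ^ 2 := by
          refine add_le_add le_rfl ?_
          exact setIntegral_le_integral hv2 (Filter.Eventually.of_forall fun t => sq_nonneg _)
  have hu : MemLp (rep f) 2 volume := (Lp.memLp (f : L2)).ae_eq (coe_ae_eq_rep f)
  refine ⟨(1 + ∫ t, ‖rep f t‖ ^ 2) + (1 + ∫ t, ‖g t‖ ^ 2), fun x => ?_⟩
  have hosc : ∀ y ∈ Set.Icc x (x + 1), ‖rep f x‖ ≤ ‖rep f y‖ + (1 + ∫ t, ‖g t‖ ^ 2) := by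
    intro y hy
    have e : rep f x = rep f y - ∫ t in x..y, g t := by
      rw [hr]
      simp only
      rw [← intervalIntegral.integral_add_adjacent_intervals (hii 0 x) (hii x y)]
      ring
    rw [e]
    refine (norm_sub_le _ _).trans ?_
    gcongr
    refine le_trans ?_ (unit_bound (Lp.memLp (weakDeriv f)) x)
    rw [intervalIntegral.integral_of_le hy.1]
    refine (norm_integral_le_integral_norm _).trans ?_
    refine setIntegral_mono_set ?_ (Filter.Eventually.of_forall fun t => norm_nonneg _)
      (Filter.Eventually.of_forall ?_)
    · exact (hg.integrableOn_isCompact isCompact_Icc).norm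
    · exact fun t ht => ⟨ht.1.le, ht.2.trans hy.2⟩
  have hci : IntegrableOn (fun y => ‖rep f y‖) (Set.Icc x (x + 1)) :=
    (continuous_rep f).norm.continuousOn.integrableOn_Icc
  have := setIntegral_mono_on (integrable_const (‖rep f x‖) : IntegrableOn _ (Set.Icc x (x + 1)))
    (hci.add (integrable_const (1 + ∫ t, ‖g t‖ ^ 2))) measurableSet_Icc hosc
  rw [integral_add hci (integrable_const _)] at this
  simp only [integral_const, MeasurableSet.univ, measureReal_restrict_apply, Set.univ_inter,
    Real.volume_real_Icc, add_sub_cancel_left, zero_le_one, sup_of_le_left, smul_eq_mul,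
    one_mul] at this
  linarith [unit_bound hu x]

/-- The sesquilinear form `a_μ(f, g) = ∫ f' conj(g') dx + ∫ f conj(g) dμ` with domain `H¹(ℝ)`, for
a finite signed Borel measure `μ` on `ℝ`. -/
def form (μ : SignedMeasure ℝ) (f g : H1) : ℂ :=
  (∫ x, (weakDeriv f : ℝ → ℂ) x * starRingEnd ℂ ((weakDeriv g : ℝ → ℂ) x)) +
    ∫ᵛ x, rep f x * starRingEnd ℂ (rep g x) ∂<•μ

lemma integrable_deriv_mul (f g : L2) :
    Integrable fun x => (f : ℝ → ℂ) x * starRingEnd ℂ ((g : ℝ → ℂ) x) := by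
  simpa [RCLike.inner_apply] using L2.integrable_inner (𝕜 := ℂ) g f

lemma integrable_rep_mul (μ : Measure ℝ) [IsFiniteMeasure μ] (f g : H1) :
    Integrable (fun x => rep f x * starRingEnd ℂ (rep g x)) μ := by
  obtain ⟨C, hC⟩ := rep_bounded f
  obtain ⟨D, hD⟩ := rep_bounded g
  refine Integrable.of_bound ((continuous_rep f).mul
    (Complex.continuous_conj.comp (continuous_rep g))).aestronglyMeasurable (C * D)
    (Filter.Eventually.of_forall fun x => ?_)
  rw [norm_mul, RCLike.norm_conj]
  exact mul_le_mul (hC x) (hD x) (norm_nonneg _) ((norm_nonneg _).trans (hC x))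

lemma form_eq (μ : SignedMeasure ℝ) (f g : H1) :
    form μ f g = (∫ x, (weakDeriv f : ℝ → ℂ) x * starRingEnd ℂ ((weakDeriv g : ℝ → ℂ) x)) +
      ((∫ x, rep f x * starRingEnd ℂ (rep g x) ∂μ.toJordanDecomposition.posPart) -
        ∫ x, rep f x * starRingEnd ℂ (rep g x) ∂μ.toJordanDecomposition.negPart) := by
  unfold form
  congr 1
  conv_lhs => rw [← μ.toSignedMeasure_toJordanDecomposition]
  unfold JordanDecomposition.toSignedMeasure
  rw [VectorMeasure.integral_sub_vectorMeasure, VectorMeasure.integral_toSignedMeasure,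
    VectorMeasure.integral_toSignedMeasure]
  · simpa [VectorMeasure.Integrable] using integrable_rep_mul _ f g
  · simpa [VectorMeasure.Integrable] using integrable_rep_mul _ f g

lemma form_add_left (μ : SignedMeasure ℝ) (f f' g : H1) :
    form μ (f + f') g = form μ f g + form μ f' g := by
  have e : ∫ x, (weakDeriv (f + f') : ℝ → ℂ) x * starRingEnd ℂ ((weakDeriv g : ℝ → ℂ) x) =
      (∫ x, (weakDeriv f : ℝ → ℂ) x * starRingEnd ℂ ((weakDeriv g : ℝ → ℂ) x)) +
      ∫ x, (weakDeriv f' : ℝ → ℂ) x * starRingEnd ℂ ((weakDeriv g : ℝ → ℂ) x) := by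
    rw [← integral_add (integrable_deriv_mul _ _) (integrable_deriv_mul _ _), weakDeriv_add]
    exact integral_congr_ae ((Lp.coeFn_add (weakDeriv f) (weakDeriv f')).mono fun x hx => by
      simp only [hx, Pi.add_apply, add_mul])
  simp only [form_eq, e, rep_add, Pi.add_apply, add_mul]
  rw [integral_add (integrable_rep_mul _ _ _) (integrable_rep_mul _ _ _),
    integral_add (integrable_rep_mul _ _ _) (integrable_rep_mul _ _ _)]
  ring

lemma form_smul_left (μ : SignedMeasure ℝ) (c : ℂ) (f g : H1) :
    form μ (c • f) g = c * form μ f g := by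
  have e : ∫ x, (weakDeriv (c • f) : ℝ → ℂ) x * starRingEnd ℂ ((weakDeriv g : ℝ → ℂ) x) =
      c * ∫ x, (weakDeriv f : ℝ → ℂ) x * starRingEnd ℂ ((weakDeriv g : ℝ → ℂ) x) := by
    rw [← integral_const_mul, weakDeriv_smul]
    exact integral_congr_ae ((Lp.coeFn_smul c (weakDeriv f)).mono fun x hx => by
      simp only [hx, Pi.smul_apply, smul_eq_mul, mul_assoc])
  simp only [form_eq, e, rep_smul, Pi.smul_apply, smul_eq_mul, mul_assoc, integral_const_mul]
  ring

lemma dense_H1 : Dense (H1 : Set L2) := by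
  refine (Lp.dense_hasCompactSupport_contDiff (p := 2) (by norm_num)).mono ?_
  rintro f ⟨u, hfu, huc, hu⟩
  have hu1 : ContDiff ℝ 1 u := hu.of_le (by simp)
  have hdc : Continuous (deriv u) := hu.continuous_deriv (by simp)
  have hd : MemLp (deriv u) 2 volume := hdc.memLp_of_hasCompactSupport huc.deriv
  refine ⟨hd.toLp, HasWeakDeriv.congr (f := u) (g := deriv u) ?_ hfu.symm hd.coeFn_toLp.symm⟩
  intro φ h1 h2
  have hφd : Continuous (deriv φ) := h1.continuous_deriv (by simp)
  have := integral_bilinear_hasDerivAt_right_eq_neg_left_of_integrable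
    (L := ContinuousLinearMap.lsmul ℝ ℝ) (u := φ) (v := u) (u' := deriv φ) (v' := deriv u)
    (fun x _ => ((h1.differentiable (by simp)) x).hasDerivAt)
    (fun x _ => ((hu1.differentiable (by simp)) x).hasDerivAt)
    ((h1.continuous.smul hdc).integrable_of_hasCompactSupport h2.smul_right)
    ((hφd.smul hu.continuous).integrable_of_hasCompactSupport h2.deriv.smul_right)
    ((h1.continuous.smul hu.continuous).integrable_of_hasCompactSupport h2.smul_right)
  simp only [ContinuousLinearMap.lsmul_apply] at this
  rw [this, neg_neg]

/-- The graph of `-Δ + μ`, the operator associated with the form `a_μ`: the pairs `(f, h)` with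
`f ∈ H¹(ℝ)`, `h ∈ L²(ℝ)` and `⟨h, g⟩ = a_μ(f, g)` for all `g ∈ H¹(ℝ)`. Mathlib's inner product is
antilinear in its first argument, so that `⟨h, g⟩` is `inner ℂ g h` here. -/
def schrodingerGraph (μ : SignedMeasure ℝ) : Submodule ℂ (L2 × L2) where
  carrier := {p | ∃ f : H1, (f : L2) = p.1 ∧ ∀ g : H1, inner ℂ (g : L2) p.2 = form μ f g}
  zero_mem' := ⟨0, rfl, fun g => by
    have := form_smul_left μ 0 0 g
    simp only [zero_smul, zero_mul] at this
    simp [this]⟩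
  add_mem' := by
    rintro p q ⟨f, hf, h⟩ ⟨f', hf', h'⟩
    exact ⟨f + f', by simp [hf, hf'], fun g => by
      rw [form_add_left, ← h g, ← h' g, Prod.snd_add, inner_add_right]⟩
  smul_mem' := by
    rintro c p ⟨f, hf, h⟩
    exact ⟨c • f, by simp [hf], fun g => by
      rw [form_smul_left, ← h g, Prod.smul_snd, inner_smul_right]⟩

lemma schrodingerGraph_functional (μ : SignedMeasure ℝ) (p : L2 × L2)
    (hp : p ∈ schrodingerGraph μ) (h0 : p.1 = 0) : p.2 = 0 := by
  obtain ⟨f, hf, h⟩ := hp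
  have hf0 : f = (0 : ℂ) • f := by
    rw [zero_smul]
    exact Subtype.ext (hf.trans h0)
  refine dense_H1.eq_zero_of_inner_right ℂ fun g hg => ?_
  rw [h ⟨g, hg⟩, hf0, form_smul_left, zero_mul]

/-- The operator `-Δ + μ` in `L²(ℝ)`, for a finite signed Borel measure `μ` on `ℝ`. -/
def schrodinger (μ : SignedMeasure ℝ) : L2 →ₗ.[ℂ] L2 := (schrodingerGraph μ).toLinearPMap

lemma schrodinger_graph (μ : SignedMeasure ℝ) :
    (schrodinger μ).graph = schrodingerGraph μ :=
  Submodule.toLinearPMap_graph_eq _ (schrodingerGraph_functional μ)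

/-- `z` is an eigenvalue of the partially defined operator `T`. -/
def IsEigenvalue (T : L2 →ₗ.[ℂ] L2) (z : ℂ) : Prop :=
  ∃ f : T.domain, (f : L2) ≠ 0 ∧ T f = z • (f : L2)

/-- The pure point measure `∑ j, α j δ_{x j}`. -/
def pointMeasure {n : ℕ} (α x : Fin n → ℝ) : SignedMeasure ℝ :=
  ∑ j, VectorMeasure.dirac (x j) (α j)

/-- The distance `x k - x (k - 1)` to the left neighbour, infinite for the first point. -/
def distLeft {n : ℕ} (x : Fin n → ℝ) (k : Fin n) : EReal :=
  if h : 0 < (k : ℕ) then ((x k - x ⟨(k : ℕ) - 1, by omega⟩ : ℝ) : EReal) else ⊤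

/-- The distance `x (k + 1) - x k` to the right neighbour, infinite for the last point. -/
def distRight {n : ℕ} (x : Fin n → ℝ) (k : Fin n) : EReal :=
  if h : (k : ℕ) + 1 < n then ((x ⟨(k : ℕ) + 1, h⟩ - x k : ℝ) : EReal) else ⊤

end DeltaSchrodinger

end

namespace DeltaSchrodinger

/-! Away from the points `x i`, an eigenfunction for the eigenvalue `-κ ^ 2` solves `f'' = κ ^ 2 f`,
so it is sought as `f = ∑ j, c j exp (-κ |t - x j|)`. Since `exp (-κ |t - y|) / (2 κ)` is the
fundamental solution of `-Δ + κ ^ 2` (`integral_expDecay_mul`), the eigenvalue equation becomes the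
finite system `2 κ c i + α i (K c) i = 0`, where `K` is the matrix `expKernel x κ` and `(K c) i = f
(x i)` (`form_expSum_add_inner`). On such `f` the form `a_μ(f, f) + κ ^ 2 ‖f‖ ^ 2` equals
`kernelForm α x κ c`.

For some small `κ` this form takes a negative value (`exists_kernelForm_neg`). The trial function
has `f (x i) = δ_{ik}` and is supported between the neighbours of `x k`, or decays exponentially on
a side without a neighbour. It is a smoothed tent, whose energy tends to `1 / d_k^- + 1 / d_k^+` as
`κ → 0`, while the point interaction contributes `α k`. For large `κ` the form is positive definite
(`kernelForm_pos`).

The minimum of the form over the unit sphere is continuous in `κ`, so it vanishes at some `κ > 0`.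
There the form is nonnegative with a nontrivial zero `c`, and first-order variation at `c` gives the
system (`exists_kernel_solution`). No spectral theory is needed beyond this finite-dimensional
argument. -/

/-! ### Weak derivatives and the fundamental theorem of calculus. -/

/-- The product rule for the product of a smooth function and a weakly differentiable one. -/
lemma HasWeakDeriv.smooth_smul {f g : ℝ → ℂ} (hf : LocallyIntegrable f) (hg : LocallyIntegrable g)
    (h : HasWeakDeriv f g) {u : ℝ → ℝ} (hu : ContDiff ℝ ∞ u) :
    HasWeakDeriv (fun x => u x • f x) (fun x => deriv u x • f x + u x • g x) := by
  intro φ h1 h2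
  have hdu : ContDiff ℝ ∞ (deriv u) := (contDiff_infty_iff_deriv.1 hu).2
  have hφd : ContDiff ℝ ∞ (deriv φ) := (contDiff_infty_iff_deriv.1 h1).2
  have hc : HasCompactSupport fun x => φ x * u x := h2.mul_right
  have key := h (fun x => φ x * u x) (h1.mul hu) hc
  have e : ∀ x, deriv (fun x => φ x * u x) x = deriv φ x * u x + φ x * deriv u x := fun x =>
    deriv_fun_mul (h1.differentiable (by simp) x) (hu.differentiable (by simp) x)
  simp only [e, add_smul] at key
  have i1 := integrable_test hf (hφd.mul hu) (h2.deriv.mul_right (f' := u))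
  have i2 := integrable_test hf (h1.mul hdu) (h2.mul_right (f' := deriv u))
  have i3 := integrable_test hg (h1.mul hu) hc
  rw [integral_add i1 i2] at key
  simp only [smul_add, ← mul_smul]
  rw [integral_add i2 i3, neg_add, ← key]
  ring

lemma HasWeakDeriv.const (c : ℂ) : HasWeakDeriv (fun _ => c) 0 := by
  intro φ h1 h2
  have hd : Continuous (deriv φ) := h1.continuous_deriv (by simp)
  have h1' : ContDiff ℝ 1 φ := h1.of_le (by simp)
  have hint : Integrable (deriv φ) := hd.integrable_of_hasCompactSupport h2.deriv
  have hd0 : ∫ x, deriv φ x = 0 := by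
    rw [← intervalIntegral.integral_Iic_add_Ioi (b := 0) hint.integrableOn hint.integrableOn,
      HasCompactSupport.integral_Ioi_deriv_eq h1' h2, HasCompactSupport.integral_Iic_deriv_eq h1' h2]
    ring
  rw [integral_smul_const, hd0]
  simp

/-- A continuous function is an integral function of its weak derivative. -/
lemma HasWeakDeriv.integral_eq_sub {f g : ℝ → ℂ} (hf : Continuous f) (hg : LocallyIntegrable g)
    (h : HasWeakDeriv f g) (a b : ℝ) : ∫ x in a..b, g x = f b - f a := by
  have hii : ∀ a b, IntervalIntegrable g volume a b := fun a b => intervalIntegrable hg a b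
  have hu : Continuous fun x => ∫ t in (0 : ℝ)..x, g t :=
    intervalIntegral.continuous_primitive hii 0
  have h2 := h.add hf.locallyIntegrable (hu.locallyIntegrable.smul (-1 : ℂ)) hg
    (hg.smul (-1 : ℂ)) ((hasWeakDeriv_integral hg).smul (-1))
  have e : g + (-1 : ℂ) • g = 0 := by simp
  rw [e] at h2
  obtain ⟨c, hc⟩ := ae_const_of_weakDeriv_zero
    (hf.locallyIntegrable.add (hu.locallyIntegrable.smul (-1 : ℂ))) h2
  -- The difference of `f` and the primitive of `g` is a.e. constant and continuous, hence constant
  -- everywhere.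
  have hfun := ((hf.add (hu.const_smul (-1 : ℂ))).ae_eq_iff_eq volume continuous_const).1 hc
  have ha := congrFun hfun a
  have hb := congrFun hfun b
  simp only [Pi.add_apply, Pi.smul_apply, smul_eq_mul] at ha hb
  rw [← intervalIntegral.integral_interval_sub_left (hii 0 b) (hii 0 a)]
  linear_combination ha - hb

/-- A continuous function with locally integrable derivative outside of one point is weakly
differentiable. -/
lemma hasWeakDeriv_of_hasDerivAt {f g : ℝ → ℂ} (hf : Continuous f) (hg : LocallyIntegrable g)
    (y : ℝ) (h : ∀ x ≠ y, HasDerivAt f (g x) x) : HasWeakDeriv f g := by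
  have hu : Continuous fun x => ∫ t in (0 : ℝ)..x, g t :=
    intervalIntegral.continuous_primitive (fun a b => intervalIntegrable hg a b) 0
  have h1 := (hasWeakDeriv_integral hg).add hu.locallyIntegrable
    continuous_const.locallyIntegrable hg (locallyIntegrable_zero) (HasWeakDeriv.const (f 0))
  refine h1.congr (Filter.Eventually.of_forall fun x => ?_)
    (Filter.Eventually.of_forall fun x => add_zero _)
  simp only [Pi.add_apply]
  rw [MeasureTheory.integral_eq_of_hasDerivAt_off_countable f g (Set.countable_singleton y)
    hf.continuousOn (fun t ht => h t ht.2) (intervalIntegrable hg 0 x)]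
  ring

lemma hasWeakDeriv_rep (g : H1) : HasWeakDeriv (rep g) (weakDeriv g) :=
  (hasWeakDeriv g).congr (coe_ae_eq_rep g) (Filter.EventuallyEq.refl _ _)

lemma memLp_rep (g : H1) : MemLp (rep g) 2 volume := (Lp.memLp (g : L2)).ae_eq (coe_ae_eq_rep g)

/-! ### The decaying exponential as an element of `H¹(ℝ)`. -/

/-- The function `exp (-κ |x - y|)`. -/
noncomputable def expDecay (κ y x : ℝ) : ℝ := Real.exp (-κ * |x - y|)

/-- The derivative of `exp (-κ |x - y|)` with respect to `x`. -/
noncomputable def expDecayDeriv (κ y x : ℝ) : ℝ := (if x ≤ y then κ else -κ) * expDecay κ y x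

lemma continuous_expDecay (κ y : ℝ) : Continuous (expDecay κ y) := by
  unfold expDecay
  fun_prop

lemma measurable_expDecayDeriv (κ y : ℝ) : Measurable (expDecayDeriv κ y) :=
  (Measurable.ite measurableSet_Iic measurable_const measurable_const).mul
    (continuous_expDecay κ y).measurable

lemma hasDerivAt_expDecay (κ : ℝ) {x y : ℝ} (h : x ≠ y) :
    HasDerivAt (expDecay κ y) (expDecayDeriv κ y x) x := by
  unfold expDecayDeriv
  have hl : ∀ a : ℝ, HasDerivAt (fun x => Real.exp (a * (x - y))) (a * Real.exp (a * (x - y))) x :=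
    fun a => by
      have := (((hasDerivAt_id x).sub_const y).const_mul a).exp
      simp only [id, mul_one] at this
      rwa [mul_comm] at this
  rcases lt_or_gt_of_ne h with h | h
  · have e : expDecay κ y =ᶠ[nhds x] fun x => Real.exp (κ * (x - y)) := by
      filter_upwards [Iio_mem_nhds h] with t ht
      rw [Set.mem_Iio] at ht
      rw [expDecay, abs_of_neg (by linarith)]
      ring_nf
    rw [if_pos h.le, e.eq_of_nhds]
    exact (hl κ).congr_of_eventuallyEq e
  · have e : expDecay κ y =ᶠ[nhds x] fun x => Real.exp (-κ * (x - y)) := by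
      filter_upwards [Ioi_mem_nhds h] with t ht
      rw [Set.mem_Ioi] at ht
      rw [expDecay, abs_of_pos (by linarith)]
    rw [if_neg h.not_ge, e.eq_of_nhds]
    exact (hl (-κ)).congr_of_eventuallyEq e

lemma integrable_expDecay {κ : ℝ} (hκ : 0 < κ) (y : ℝ) : Integrable (expDecay κ y) := by
  have h0 : Integrable fun x : ℝ => Real.exp (-κ * |x|) := by
    rw [← integrableOn_univ, ← Set.Iic_union_Ioi (a := (0 : ℝ))]
    refine IntegrableOn.union ?_ ?_
    · refine (integrableOn_exp_mul_Iic hκ 0).congr_fun (fun x hx => ?_) measurableSet_Iic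
      simp only
      rw [abs_of_nonpos hx]
      ring_nf
    · refine (integrableOn_exp_mul_Ioi (neg_lt_zero.2 hκ) 0).congr_fun (fun x hx => ?_)
        measurableSet_Ioi
      simp only
      rw [abs_of_pos hx]
  exact h0.comp_sub_right y

lemma memLp_expDecay {κ : ℝ} (hκ : 0 < κ) (y : ℝ) :
    MemLp (fun x => (expDecay κ y x : ℂ)) 2 volume := by
  refine (memLp_two_iff_integrable_sq_norm
    (Complex.continuous_ofReal.comp (continuous_expDecay κ y)).aestronglyMeasurable).2 ?_
  -- Squaring doubles the decay rate.
  refine (integrable_expDecay (κ := 2 * κ) (by positivity) y).congr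
    (Filter.Eventually.of_forall fun x => ?_)
  simp only [Function.comp_apply, Complex.norm_real, expDecay, Real.norm_eq_abs, Real.abs_exp, ← Real.exp_nat_mul]
  push_cast
  ring_nf

lemma memLp_expDecayDeriv {κ : ℝ} (hκ : 0 < κ) (y : ℝ) :
    MemLp (fun x => (expDecayDeriv κ y x : ℂ)) 2 volume := by
  refine MemLp.of_le ((memLp_expDecay hκ y).const_mul (κ : ℂ))
    (Complex.measurable_ofReal.comp (measurable_expDecayDeriv κ y)).aestronglyMeasurable
    (Filter.Eventually.of_forall fun x => ?_)
  rw [← Complex.ofReal_mul, Complex.norm_real, Complex.norm_real, expDecayDeriv, norm_mul, norm_mul]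
  split_ifs <;> simp

lemma hasWeakDeriv_expDecay {κ : ℝ} (hκ : 0 < κ) (y : ℝ) :
    HasWeakDeriv (fun x => (expDecay κ y x : ℂ)) fun x => (expDecayDeriv κ y x : ℂ) :=
  hasWeakDeriv_of_hasDerivAt (Complex.continuous_ofReal.comp (continuous_expDecay κ y))
    ((memLp_expDecayDeriv hκ y).locallyIntegrable (by norm_num)) y
    fun _ hx => (hasDerivAt_expDecay κ hx).ofReal_comp

/-- The function `exp (-κ |x - y|)` as an element of `H¹(ℝ)`. -/
noncomputable def expH1 {κ : ℝ} (hκ : 0 < κ) (y : ℝ) : H1 :=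
  ⟨(memLp_expDecay hκ y).toLp, (memLp_expDecayDeriv hκ y).toLp,
    (hasWeakDeriv_expDecay hκ y).congr (memLp_expDecay hκ y).coeFn_toLp.symm
      (memLp_expDecayDeriv hκ y).coeFn_toLp.symm⟩

lemma rep_expH1 {κ : ℝ} (hκ : 0 < κ) (y : ℝ) : rep (expH1 hκ y) = fun x => (expDecay κ y x : ℂ) :=
  rep_eq (Complex.continuous_ofReal.comp (continuous_expDecay κ y))
    (memLp_expDecay hκ y).coeFn_toLp

lemma weakDeriv_expH1 {κ : ℝ} (hκ : 0 < κ) (y : ℝ) :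
    weakDeriv (expH1 hκ y) = (memLp_expDecayDeriv hκ y).toLp :=
  weakDeriv_eq ((hasWeakDeriv_expDecay hκ y).congr (memLp_expDecay hκ y).coeFn_toLp.symm
      (memLp_expDecayDeriv hκ y).coeFn_toLp.symm)

/-! ### The fundamental solution of `-Δ + κ ^ 2` and the form of a point measure. -/

/-- The fundamental theorem of calculus for `exp (a (x - y)) g x`. -/
lemma integral_exp_mul_rep (g : H1) (a y s t : ℝ) :
    ∫ x in s..t, ((a * Real.exp (a * (x - y))) • rep g x +
        Real.exp (a * (x - y)) • (weakDeriv g : ℝ → ℂ) x) =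
      Real.exp (a * (t - y)) • rep g t - Real.exp (a * (s - y)) • rep g s := by
  have hu : ContDiff ℝ ∞ fun x : ℝ => Real.exp (a * (x - y)) := by fun_prop
  have hd : deriv (fun x : ℝ => Real.exp (a * (x - y))) = fun x => a * Real.exp (a * (x - y)) := by
    ext x
    have := (((hasDerivAt_id x).sub_const y).const_mul a).exp
    simp only [id, mul_one] at this
    rw [this.deriv, mul_comm]
  have h := (hasWeakDeriv_rep g).smooth_smul (continuous_rep g).locallyIntegrable
    (locallyIntegrable _) hu
  rw [hd] at h
  refine h.integral_eq_sub (hu.continuous.smul (continuous_rep g)) ?_ s t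
  have hc : Continuous fun x : ℝ => (a * Real.exp (a * (x - y))) • rep g x :=
    (hu.continuous.const_smul a).smul (continuous_rep g)
  refine hc.locallyIntegrable.add ?_
  rw [← locallyIntegrableOn_univ]
  exact (locallyIntegrableOn_univ.2 (locallyIntegrable (weakDeriv g))).continuousOn_smul
    isOpen_univ.isLocallyClosed hu.continuous.continuousOn

lemma tendsto_smul_rep (g : H1) {l : Filter ℝ} {u : ℝ → ℝ} (hu : Filter.Tendsto u l (nhds 0)) :
    Filter.Tendsto (fun x => u x • rep g x) l (nhds 0) := by
  obtain ⟨C, hC⟩ := rep_bounded g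
  refine squeeze_zero_norm (a := fun x => ‖u x‖ * C) (fun x => ?_) ?_
  · rw [norm_smul]
    exact mul_le_mul_of_nonneg_left (hC x) (norm_nonneg _)
  · simpa using hu.norm.mul_const C

/-- The function `exp (-κ |x - y|) / (2 κ)` is the fundamental solution of `-Δ + κ²`. -/
lemma integral_expDecay_mul (g : H1) {κ : ℝ} (hκ : 0 < κ) (y : ℝ) :
    ∫ x, ((expDecayDeriv κ y x : ℂ) * (weakDeriv g : ℝ → ℂ) x +
      κ ^ 2 * ((expDecay κ y x : ℂ) * rep g x)) = 2 * κ * rep g y := by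
  have hi : Integrable fun x => (expDecayDeriv κ y x : ℂ) * (weakDeriv g : ℝ → ℂ) x +
      κ ^ 2 * ((expDecay κ y x : ℂ) * rep g x) :=
    ((memLp_expDecayDeriv hκ y).integrable_mul (Lp.memLp (weakDeriv g))).add
      (((memLp_expDecay hκ y).integrable_mul (memLp_rep g)).const_mul _)
  rw [← intervalIntegral.integral_Iic_add_Ioi (b := y) hi.integrableOn hi.integrableOn]
  have hlin : Filter.Tendsto (fun x => κ * (x - y)) Filter.atTop Filter.atTop :=
    (Filter.tendsto_atTop_add_const_right _ (-y) Filter.tendsto_id).const_mul_atTop hκ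
  -- Left of `y`, with `e = exp (κ (x - y))`, the integrand is `κ (e g)'`. Only the boundary term at
  -- `y` survives, since `g` is bounded and `e → 0`. The convention `x ≤ y` in `expDecayDeriv` makes
  -- this pointwise true at `y` as well.
  have e1 : ∫ x in Set.Iic y, ((expDecayDeriv κ y x : ℂ) * (weakDeriv g : ℝ → ℂ) x +
      κ ^ 2 * ((expDecay κ y x : ℂ) * rep g x)) = κ * rep g y := by
    refine tendsto_nhds_unique
      (intervalIntegral_tendsto_integral_Iic y hi.integrableOn Filter.tendsto_id) ?_
    have hlin' : Filter.Tendsto (fun x => κ * (x - y)) Filter.atBot Filter.atBot :=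
      (Filter.tendsto_atBot_add_const_right _ (-y) Filter.tendsto_id).const_mul_atBot hκ
    have hl := (tendsto_smul_rep g (Real.tendsto_exp_atBot.comp hlin')).const_sub (rep g y)
    rw [sub_zero] at hl
    refine (hl.const_mul (κ : ℂ)).congr' ?_
    filter_upwards [Filter.eventually_le_atBot y] with s hs
    have := integral_exp_mul_rep g κ y s y
    simp only [sub_self, mul_zero, Real.exp_zero, one_smul] at this
    simp only [Function.comp_apply, id]
    rw [← this, ← intervalIntegral.integral_const_mul]
    refine intervalIntegral.integral_congr fun x hx => ?_
    rw [Set.uIcc_of_le hs] at hx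
    have e : expDecay κ y x = Real.exp (κ * (x - y)) := by
      rw [expDecay, abs_of_nonpos (by linarith [hx.2])]
      ring_nf
    simp only [expDecayDeriv, if_pos hx.2, e, Complex.real_smul]
    push_cast
    ring
  -- Right of `y` the integrand is `-κ (e g)'` with `e = exp (-κ (x - y))`. The boundary value at
  -- `y` is now the lower one, so the two signs cancel.
  have e2 : ∫ x in Set.Ioi y, ((expDecayDeriv κ y x : ℂ) * (weakDeriv g : ℝ → ℂ) x +
      κ ^ 2 * ((expDecay κ y x : ℂ) * rep g x)) = κ * rep g y := by
    refine tendsto_nhds_unique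
      (intervalIntegral_tendsto_integral_Ioi y hi.integrableOn Filter.tendsto_id) ?_
    have hlin' : Filter.Tendsto (fun x => -κ * (x - y)) Filter.atTop Filter.atBot := by
      simpa only [neg_mul, Function.comp_def] using Filter.tendsto_neg_atTop_atBot.comp hlin
    have hl := (tendsto_smul_rep g (Real.tendsto_exp_atBot.comp hlin')).sub_const (rep g y)
    rw [zero_sub] at hl
    have hl' := hl.const_mul (-κ : ℂ)
    rw [neg_mul_neg] at hl'
    refine hl'.congr' ?_
    filter_upwards [Filter.eventually_ge_atTop y] with s hs
    have := integral_exp_mul_rep g (-κ) y y s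
    simp only [sub_self, mul_zero, Real.exp_zero, one_smul] at this
    simp only [Function.comp_apply, id]
    rw [← this, ← intervalIntegral.integral_const_mul, intervalIntegral.integral_of_le hs,
      intervalIntegral.integral_of_le hs]
    refine setIntegral_congr_fun measurableSet_Ioc fun x hx => ?_
    have e : expDecay κ y x = Real.exp (-κ * (x - y)) := by
      rw [expDecay, abs_of_pos (by linarith [hx.1])]
    simp only [expDecayDeriv, if_neg (not_le.2 hx.1), e, Complex.real_smul]
    push_cast
    ring
  rw [e1, e2]
  ring

/-- This is the complex conjugate of `integral_expDecay_mul`: the exponential is real, and the form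
and `inner ℂ g h` are antilinear in `g`. -/
lemma integral_weakDeriv_expH1_add_inner (g : H1) {κ : ℝ} (hκ : 0 < κ) (y : ℝ) :
    (∫ x, (weakDeriv (expH1 hκ y) : ℝ → ℂ) x * starRingEnd ℂ ((weakDeriv g : ℝ → ℂ) x)) +
      κ ^ 2 * inner ℂ (g : L2) (expH1 hκ y : L2) = 2 * κ * starRingEnd ℂ (rep g y) := by
  have h := congrArg (starRingEnd ℂ) (integral_expDecay_mul g hκ y)
  rw [← integral_conj] at h
  have hr : starRingEnd ℂ (2 * κ * rep g y) = 2 * κ * starRingEnd ℂ (rep g y) := by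
    simp only [map_mul, Complex.conj_ofReal, map_ofNat]
  have hin : Integrable fun x => ((expH1 hκ y : L2) : ℝ → ℂ) x *
      starRingEnd ℂ (((g : L2) : ℝ → ℂ) x) := integrable_deriv_mul _ _
  have e : inner ℂ (g : L2) (expH1 hκ y : L2) = ∫ x, ((expH1 hκ y : L2) : ℝ → ℂ) x *
      starRingEnd ℂ (((g : L2) : ℝ → ℂ) x) := by
    simp [L2.inner_def, RCLike.inner_apply]
  rw [← hr, ← h, e, ← integral_const_mul, ← integral_add (integrable_deriv_mul _ _)
    (hin.const_mul _)]
  refine integral_congr_ae ?_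
  have h1 : (weakDeriv (expH1 hκ y) : ℝ → ℂ) =ᵐ[volume] _ :=
    (weakDeriv_expH1 hκ y) ▸ (memLp_expDecayDeriv hκ y).coeFn_toLp
  filter_upwards [h1, coe_ae_eq_rep (expH1 hκ y), coe_ae_eq_rep g] with x a b c
  rw [a, b, c, rep_expH1]
  simp

lemma form_pointMeasure {n : ℕ} (α x : Fin n → ℝ) (f g : H1) :
    form (pointMeasure α x) f g =
      (∫ t, (weakDeriv f : ℝ → ℂ) t * starRingEnd ℂ ((weakDeriv g : ℝ → ℂ) t)) +
        ∑ i, α i * (rep f (x i) * starRingEnd ℂ (rep g (x i))) := by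
  unfold form pointMeasure
  congr 1
  rw [VectorMeasure.integral_finsetSum_vectorMeasure]
  · simp
  · intro i _
    -- The variation of `α i δ_{x i}` is `|α i|` times the Dirac measure.
    have := (integrable_rep_mul (Measure.dirac (x i)) f g).smul_measure
      (c := ‖α i‖ₑ) (by simp)
    simpa [VectorMeasure.Integrable] using this

/-! ### The exponential kernel matrix and the columns of its inverse. -/

open Matrix

/-- The matrix `exp (-κ |x i - x j|)`. -/
noncomputable def expKernel {n : ℕ} (x : Fin n → ℝ) (κ : ℝ) : Matrix (Fin n) (Fin n) ℝ :=
  Matrix.of fun i j => Real.exp (-κ * |x i - x j|)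

lemma expKernel_apply {n : ℕ} (x : Fin n → ℝ) (κ : ℝ) (i j : Fin n) :
    expKernel x κ i j = Real.exp (-κ * |x i - x j|) := rfl

lemma expKernel_self {n : ℕ} (x : Fin n → ℝ) (κ : ℝ) (i : Fin n) : expKernel x κ i i = 1 := by
  simp [expKernel_apply]

lemma expKernel_dotProduct_comm {n : ℕ} (x : Fin n → ℝ) (κ : ℝ) (c d : Fin n → ℝ) :
    c ⬝ᵥ expKernel x κ *ᵥ d = d ⬝ᵥ expKernel x κ *ᵥ c := by
  have h : (expKernel x κ)ᵀ = expKernel x κ := by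
    ext i j
    simp [expKernel_apply, abs_sub_comm]
  rw [dotProduct_mulVec, ← mulVec_transpose, h, dotProduct_comm]

/-- The combination of the columns `k` and `m` of the exponential kernel which cancels the part of
the column `k` on the side of `m`. -/
lemma exists_mulVec_expKernel_eq_ite {n : ℕ} (x : Fin n → ℝ) {κ d : ℝ} (hκ : 0 < κ) (hd : 0 < d)
    {k m : Fin n} (hkm : k ≠ m) (P : Fin n → Prop) [DecidablePred P]
    (h1 : ∀ i, P i → |x i - x k| = |x i - x m| + d)
    (h2 : ∀ i, ¬ P i → |x i - x m| = |x i - x k| + d) :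
    ∃ w : Fin n → ℝ, (∀ i, (expKernel x κ *ᵥ w) i = if P i then expKernel x κ i k else 0) ∧
      -(2 * κ * w k) ≤ 1 / d := by
  have hD : 0 < Real.exp (2 * κ * d) - 1 := by
    have := Real.add_one_le_exp (2 * κ * d)
    have : 0 < 2 * κ * d := by positivity
    linarith
  -- Where `P i` holds, `K i m = exp (κ d) K i k`; elsewhere `K i k = exp (κ d) K i m`. The second
  -- relation fixes the ratio of the two coefficients, so that the combination vanishes off `P`, and
  -- the first fixes their size.
  refine ⟨Pi.single m (Real.exp (κ * d) / (Real.exp (2 * κ * d) - 1)) -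
    Pi.single k (1 / (Real.exp (2 * κ * d) - 1)), fun i => ?_, ?_⟩
  · rw [mulVec_sub]
    simp only [Pi.sub_apply, mulVec_single, op_smul_eq_smul, Pi.smul_apply, col_apply,
      smul_eq_mul, expKernel_apply]
    have e2 : Real.exp (2 * κ * d) = Real.exp (κ * d) * Real.exp (κ * d) := by
      rw [← Real.exp_add]; ring_nf
    split_ifs with hi
    · have e1 : Real.exp (-κ * |x i - x m|) = Real.exp (κ * d) * Real.exp (-κ * |x i - x k|) := by
        rw [← Real.exp_add, h1 i hi]; ring_nf
      rw [e2] at hD ⊢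
      rw [e1]
      field_simp
      rw [pow_two, div_self hD.ne']
    · have e1 : Real.exp (-κ * |x i - x k|) = Real.exp (κ * d) * Real.exp (-κ * |x i - x m|) := by
        rw [← Real.exp_add, h2 i hi]; ring_nf
      rw [e1]
      ring
  · simp only [Pi.sub_apply, Pi.single_eq_same, Pi.single_eq_of_ne hkm]
    -- The bound is `2 κ / (exp (2 κ d) - 1) ≤ 1 / d`, from `exp t ≥ 1 + t`.
    have := Real.add_one_le_exp (2 * κ * d)
    rw [zero_sub, mul_neg, neg_neg, mul_one_div, div_le_div_iff₀ hD hd]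
    linarith

/-- The inverse distance to the left neighbour, zero for the first point. -/
noncomputable def invDistLeft {n : ℕ} (x : Fin n → ℝ) (k : Fin n) : ℝ :=
  if h : 0 < (k : ℕ) then 1 / (x k - x ⟨(k : ℕ) - 1, by omega⟩) else 0

/-- The inverse distance to the right neighbour, zero for the last point. -/
noncomputable def invDistRight {n : ℕ} (x : Fin n → ℝ) (k : Fin n) : ℝ :=
  if h : (k : ℕ) + 1 < n then 1 / (x ⟨(k : ℕ) + 1, h⟩ - x k) else 0

lemma one_div_distLeft {n : ℕ} (x : Fin n → ℝ) (k : Fin n) :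
    1 / distLeft x k = (invDistLeft x k : EReal) := by
  unfold distLeft invDistLeft
  split_ifs with h
  · rw [← EReal.coe_one, ← EReal.coe_div]
  · simp

lemma one_div_distRight {n : ℕ} (x : Fin n → ℝ) (k : Fin n) :
    1 / distRight x k = (invDistRight x k : EReal) := by
  unfold distRight invDistRight
  split_ifs with h
  · rw [← EReal.coe_one, ← EReal.coe_div]
  · simp

/-- The neighbour `m = k - 1` separates `x k` from all points to its left, so distances to `x k` and
`x m` differ by exactly `x k - x m`, with a sign depending on the side. For the first point no `i <
k` exists and `w = 0` works. -/
lemma exists_mulVec_expKernel_left {n : ℕ} {x : Fin n → ℝ} (hx : StrictMono x) {κ : ℝ}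
    (hκ : 0 < κ) (k : Fin n) :
    ∃ w : Fin n → ℝ, (∀ i, (expKernel x κ *ᵥ w) i = if i < k then expKernel x κ i k else 0) ∧
      -(2 * κ * w k) ≤ invDistLeft x k := by
  unfold invDistLeft
  split_ifs with h
  · set m : Fin n := ⟨(k : ℕ) - 1, by omega⟩ with hm
    have hmk : m < k := by
      rw [Fin.lt_def]
      simp only [hm]
      omega
    refine exists_mulVec_expKernel_eq_ite x hκ (sub_pos.2 (hx hmk)) hmk.ne' _
      (fun i hi => ?_) fun i hi => ?_
    · have him : i ≤ m := by
        rw [Fin.lt_def] at hi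
        rw [Fin.le_def]
        simp only [hm]
        omega
      have a := hx.monotone him
      have b := hx hmk
      rw [abs_of_nonpos (by linarith), abs_of_nonpos (by linarith)]
      ring
    · have a := hx.monotone (not_lt.1 hi)
      have b := hx hmk
      rw [abs_of_nonneg (by linarith), abs_of_nonneg (by linarith)]
      ring
  · refine ⟨0, fun i => ?_, by simp⟩
    rw [if_neg]
    · simp
    · rw [Fin.lt_def]
      omega

lemma exists_mulVec_expKernel_right {n : ℕ} {x : Fin n → ℝ} (hx : StrictMono x) {κ : ℝ}
    (hκ : 0 < κ) (k : Fin n) :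
    ∃ w : Fin n → ℝ, (∀ i, (expKernel x κ *ᵥ w) i = if k < i then expKernel x κ i k else 0) ∧
      -(2 * κ * w k) ≤ invDistRight x k := by
  unfold invDistRight
  split_ifs with h
  · set m : Fin n := ⟨(k : ℕ) + 1, h⟩ with hm
    have hmk : k < m := by
      rw [Fin.lt_def]
      simp only [hm]
      omega
    refine exists_mulVec_expKernel_eq_ite x hκ (sub_pos.2 (hx hmk)) hmk.ne _
      (fun i hi => ?_) fun i hi => ?_
    · have him : m ≤ i := by
        rw [Fin.lt_def] at hi
        rw [Fin.le_def]
        simp only [hm]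
        omega
      have a := hx.monotone him
      have b := hx hmk
      rw [abs_of_nonneg (by linarith), abs_of_nonneg (by linarith)]
      ring
    · have a := hx.monotone (not_lt.1 hi)
      have b := hx hmk
      rw [abs_of_nonpos (by linarith), abs_of_nonpos (by linarith)]
      ring
  · refine ⟨0, fun i => ?_, by simp⟩
    rw [if_neg]
    · simp
    · have := i.2
      rw [Fin.lt_def]
      omega

/-- The columns of the inverse of the exponential kernel, with a bound on the diagonal. -/
lemma exists_mulVec_expKernel_eq_single {n : ℕ} {x : Fin n → ℝ} (hx : StrictMono x) {κ : ℝ}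
    (hκ : 0 < κ) (k : Fin n) :
    ∃ c : Fin n → ℝ, expKernel x κ *ᵥ c = Pi.single k 1 ∧
      2 * κ * c k ≤ 2 * κ + (invDistLeft x k + invDistRight x k) := by
  obtain ⟨w, hw, hwk⟩ := exists_mulVec_expKernel_left hx hκ k
  obtain ⟨v, hv, hvk⟩ := exists_mulVec_expKernel_right hx hκ k
  -- Subtracting `w` and `v` removes column `k` of the kernel to the left and right of row `k`,
  -- leaving only the diagonal entry `1`.
  refine ⟨Pi.single k 1 - w - v, ?_, ?_⟩
  · ext i
    rw [mulVec_sub, mulVec_sub, Pi.sub_apply, Pi.sub_apply, hw, hv, mulVec_single_one, col_apply]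
    rcases lt_trichotomy i k with h | rfl | h
    · simp [h, h.not_gt, h.ne]
    · simp [expKernel_self]
    · simp [h, h.not_gt, h.ne']
  · simp only [Pi.sub_apply, Pi.single_eq_same]
    linarith

/-! ### The quadratic form on coefficients and the choice of `κ`. -/

/-- The quadratic form `2 κ cᵀ K c + ∑ i, α i (K c) i ^ 2` with `K` the exponential kernel. -/
noncomputable def kernelForm {n : ℕ} (α x : Fin n → ℝ) (κ : ℝ) (c : Fin n → ℝ) : ℝ :=
  2 * κ * (c ⬝ᵥ expKernel x κ *ᵥ c) + ∑ i, α i * (expKernel x κ *ᵥ c) i ^ 2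

/-- The coefficient of `2 t` is the associated bilinear form, which is tested at a minimizer;
symmetry of the kernel merges the two cross terms. -/
lemma kernelForm_add_smul {n : ℕ} (α x : Fin n → ℝ) (κ : ℝ) (c d : Fin n → ℝ) (t : ℝ) :
    kernelForm α x κ (c + t • d) = kernelForm α x κ c +
      2 * t * (2 * κ * (c ⬝ᵥ expKernel x κ *ᵥ d) +
        ∑ i, α i * (expKernel x κ *ᵥ c) i * (expKernel x κ *ᵥ d) i) +
      t ^ 2 * kernelForm α x κ d := by
  have e : ∑ i, α i * (expKernel x κ *ᵥ (c + t • d)) i ^ 2 =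
      ∑ i, α i * (expKernel x κ *ᵥ c) i ^ 2 +
      2 * t * ∑ i, α i * (expKernel x κ *ᵥ c) i * (expKernel x κ *ᵥ d) i +
      t ^ 2 * ∑ i, α i * (expKernel x κ *ᵥ d) i ^ 2 := by
    rw [Finset.mul_sum, Finset.mul_sum, ← Finset.sum_add_distrib, ← Finset.sum_add_distrib]
    refine Finset.sum_congr rfl fun i _ => ?_
    rw [mulVec_add, mulVec_smul]
    simp only [Pi.add_apply, Pi.smul_apply, smul_eq_mul]
    ring
  unfold kernelForm
  rw [e, mulVec_add, mulVec_smul]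
  simp only [dotProduct_add, add_dotProduct, smul_dotProduct, dotProduct_smul, smul_eq_mul]
  rw [expKernel_dotProduct_comm x κ d c]
  ring

lemma kernelForm_smul {n : ℕ} (α x : Fin n → ℝ) (κ : ℝ) (c : Fin n → ℝ) (t : ℝ) :
    kernelForm α x κ (t • c) = t ^ 2 * kernelForm α x κ c := by
  have := kernelForm_add_smul α x κ 0 c t
  simpa [kernelForm] using this

lemma continuous_kernelForm {n : ℕ} (α x : Fin n → ℝ) :
    Continuous fun p : ℝ × (Fin n → ℝ) => kernelForm α x p.1 p.2 := by
  unfold kernelForm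
  simp only [dotProduct, mulVec, expKernel_apply]
  fun_prop

/-- With `K c = e_k` the form collapses to `2 κ c k + α k`, which the diagonal bound for the inverse
kernel controls. -/
lemma exists_kernelForm_neg {n : ℕ} {α x : Fin n → ℝ} (hx : StrictMono x) {k : Fin n}
    (hd : invDistLeft x k + invDistRight x k < -α k) :
    ∃ κ > 0, ∃ c, kernelForm α x κ c < 0 := by
  -- Any positive `κ` with `2 κ` below the gap in the hypothesis works; here `2 κ` is half of it.
  refine ⟨(-α k - (invDistLeft x k + invDistRight x k)) / 4, by linarith, ?_⟩
  set κ := (-α k - (invDistLeft x k + invDistRight x k)) / 4 with hκ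
  obtain ⟨c, hc, hck⟩ := exists_mulVec_expKernel_eq_single hx (κ := κ) (by linarith) k
  refine ⟨c, ?_⟩
  unfold kernelForm
  rw [hc]
  simp only [dotProduct_single, mul_one, Pi.single_apply, ite_pow, one_pow,
    mul_ite, Finset.sum_ite_eq', Finset.mem_univ, if_true, ne_eq, OfNat.ofNat_ne_zero,
    not_false_eq_true, zero_pow, mul_zero]
  linarith

/-- The Cauchy-Schwarz inequality for the exponential kernel. -/
lemma sq_mulVec_expKernel_le {n : ℕ} (x : Fin n → ℝ) {κ : ℝ}
    (hK : ∀ c, 0 ≤ c ⬝ᵥ expKernel x κ *ᵥ c) (c : Fin n → ℝ) (j : Fin n) :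
    (expKernel x κ *ᵥ c) j ^ 2 ≤ c ⬝ᵥ expKernel x κ *ᵥ c := by
  -- Subtract the `K`-orthogonal projection of `c` onto `e_j`, using `K j j = 1`.
  have h := hK (c - (expKernel x κ *ᵥ c) j • Pi.single j 1)
  rw [mulVec_sub, mulVec_smul] at h
  simp only [dotProduct_sub, sub_dotProduct, smul_dotProduct, dotProduct_smul, smul_eq_mul] at h
  rw [expKernel_dotProduct_comm x κ c (Pi.single j 1)] at h
  simp only [single_dotProduct, mulVec_single_one, col_apply, expKernel_self, one_mul] at h
  linarith

/-- By Cauchy-Schwarz the form is at least `(2 κ - ∑ i, |α i|) (cᵀ K c)`. Strict positivity of `cᵀ K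
c` follows because its vanishing forces `K c = 0`, and `K` is injective: pair `K c` with the columns
of its inverse. -/
lemma kernelForm_pos {n : ℕ} {α x : Fin n → ℝ} (hx : StrictMono x) {κ : ℝ} (hκ : 0 < κ)
    (hK : ∀ c, 0 ≤ c ⬝ᵥ expKernel x κ *ᵥ c) (hα : ∑ i, |α i| < 2 * κ) {c : Fin n → ℝ}
    (hc : c ≠ 0) : 0 < kernelForm α x κ c := by
  have hpos : 0 < c ⬝ᵥ expKernel x κ *ᵥ c := by
    refine lt_of_le_of_ne (hK c) fun h0 => hc ?_
    have hv : expKernel x κ *ᵥ c = 0 := by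
      ext j
      have := sq_mulVec_expKernel_le x hK c j
      rw [← h0] at this
      simpa using pow_eq_zero_iff (two_ne_zero) |>.1 (le_antisymm this (sq_nonneg _))
    ext j
    obtain ⟨d, hd, -⟩ := exists_mulVec_expKernel_eq_single hx hκ j
    have := expKernel_dotProduct_comm x κ c d
    rw [hv, hd] at this
    simpa using this
  have h : -((∑ i, |α i|) * (c ⬝ᵥ expKernel x κ *ᵥ c)) ≤
      ∑ i, α i * (expKernel x κ *ᵥ c) i ^ 2 := by
    rw [Finset.sum_mul, ← Finset.sum_neg_distrib]
    refine Finset.sum_le_sum fun i _ => ?_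
    have h1 := mul_le_mul_of_nonneg_left (sq_mulVec_expKernel_le x hK c i) (abs_nonneg (α i))
    have h2 := mul_le_mul_of_nonneg_right (neg_abs_le (α i)) (sq_nonneg ((expKernel x κ *ᵥ c) i))
    linarith
  unfold kernelForm
  nlinarith [mul_pos (sub_pos.2 hα) hpos]

/-- There is a `κ > 0` at which the eigenvalue equation has a non-trivial solution. -/
lemma exists_kernel_solution {n : ℕ} {α x : Fin n → ℝ} (hx : StrictMono x)
    (hK : ∀ κ > 0, ∀ c, 0 ≤ c ⬝ᵥ expKernel x κ *ᵥ c) {k : Fin n}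
    (hd : invDistLeft x k + invDistRight x k < -α k) :
    ∃ κ > 0, ∃ c : Fin n → ℝ, c ≠ 0 ∧ ∀ i, 2 * κ * c i + α i * (expKernel x κ *ᵥ c) i = 0 := by
  obtain ⟨a, ha, c₀, hc₀⟩ := exists_kernelForm_neg hx hd
  have hc₀0 : c₀ ≠ 0 := by
    rintro rfl
    simp [kernelForm] at hc₀
  set S : Set (Fin n → ℝ) := Metric.sphere 0 1 with hS
  have hSc : IsCompact S := isCompact_sphere 0 1
  have hnorm : ∀ c : Fin n → ℝ, c ≠ 0 → ‖c‖⁻¹ • c ∈ S := fun c hc => by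
    simp [hS, norm_smul, hc]
  have hSn : S.Nonempty := ⟨_, hnorm c₀ hc₀0⟩
  have hcont : ∀ κ, Continuous (kernelForm α x κ) := fun κ =>
    (continuous_kernelForm α x).comp (Continuous.prodMk_right κ)
  have hmc : Continuous fun κ => sInf (kernelForm α x κ '' S) :=
    hSc.continuous_sInf (continuous_kernelForm α x)
  have hmin : ∀ κ, ∃ c ∈ S, sInf (kernelForm α x κ '' S) = kernelForm α x κ c ∧
      ∀ d ∈ S, kernelForm α x κ c ≤ kernelForm α x κ d := fun κ =>
    hSc.exists_sInf_image_eq_and_le hSn (hcont κ).continuousOn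
  have hS0 : ∀ c ∈ S, c ≠ 0 := fun c hc h0 => by simp [hS, h0] at hc
  set b : ℝ := ∑ i, |α i| + 1 with hb
  have hb0 : 0 ≤ ∑ i, |α i| := Finset.sum_nonneg fun i _ => abs_nonneg _
  have hma : sInf (kernelForm α x a '' S) ≤ 0 := by
    obtain ⟨c, -, he, hle⟩ := hmin a
    rw [he]
    refine (hle _ (hnorm c₀ hc₀0)).trans ?_
    rw [kernelForm_smul]
    exact mul_nonpos_of_nonneg_of_nonpos (sq_nonneg _) hc₀.le
  have hmb : 0 ≤ sInf (kernelForm α x b '' S) := by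
    obtain ⟨c, hc, he, -⟩ := hmin b
    rw [he]
    exact (kernelForm_pos hx (by linarith) (hK b (by linarith)) (by linarith) (hS0 c hc)).le
  -- The order of `a` and `b` is not known, hence the unordered interval; both endpoints are
  -- positive, so `κ` is too.
  obtain ⟨κ, hκ, hκ0⟩ := intermediate_value_uIcc hmc.continuousOn
    (Set.Icc_subset_uIcc ⟨hma, hmb⟩)
  have hκpos : 0 < κ := (lt_min ha (by linarith)).trans_le hκ.1
  obtain ⟨c, hc, he, hle⟩ := hmin κ
  have he0 : kernelForm α x κ c = 0 := he.symm.trans hκ0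
  refine ⟨κ, hκpos, c, hS0 c hc, fun i => ?_⟩
  have hnn : ∀ d, 0 ≤ kernelForm α x κ d := fun d => by
    rcases eq_or_ne d 0 with rfl | hd0
    · simp [kernelForm]
    · have := hle _ (hnorm d hd0)
      rw [he0, kernelForm_smul] at this
      exact nonneg_of_mul_nonneg_right this (by positivity)
  -- Varying in the direction `d` with `K d = e_i` isolates the `i`-th equation: the linear term at
  -- `c` is `2 t β`.
  obtain ⟨d, hdi, -⟩ := exists_mulVec_expKernel_eq_single hx hκpos i
  set β := 2 * κ * c i + α i * (expKernel x κ *ᵥ c) i with hβ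
  have hquad : ∀ t : ℝ, 0 ≤ kernelForm α x κ d * (t * t) + 2 * β * t + 0 := fun t => by
    have := hnn (c + t • d)
    rw [kernelForm_add_smul, he0, hdi] at this
    simp only [dotProduct_single, mul_one, Pi.single_apply, mul_ite, mul_zero, Finset.sum_ite_eq',
      Finset.mem_univ, if_true] at this
    rw [← hβ] at this
    linarith
  -- The constant term is `0`, so the discriminant is `(2 β) ^ 2` and `β` must vanish.
  have := discrim_le_zero hquad
  rw [discrim] at this
  nlinarith [sq_nonneg β]

/-! ### Sums of exponentials as eigenvectors. -/

lemma form_sum_smul_left {ι : Type*} (μ : SignedMeasure ℝ) (s : Finset ι) (c : ι → ℂ) (f : ι → H1)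
    (g : H1) : form μ (∑ j ∈ s, c j • f j) g = ∑ j ∈ s, c j * form μ (f j) g := by
  classical
  induction s using Finset.induction_on with
  | empty => simpa using form_smul_left μ 0 0 g
  | insert a s ha ih =>
    rw [Finset.sum_insert ha, Finset.sum_insert ha, form_add_left, form_smul_left, ih]

lemma rep_sum_smul {ι : Type*} (s : Finset ι) (c : ι → ℂ) (f : ι → H1) (t : ℝ) :
    rep (∑ j ∈ s, c j • f j) t = ∑ j ∈ s, c j * rep (f j) t := by
  classical
  induction s using Finset.induction_on with
  | empty => simpa using congrFun (rep_smul 0 0) t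
  | insert a s ha ih =>
    rw [Finset.sum_insert ha, Finset.sum_insert ha, rep_add, Pi.add_apply, rep_smul, ih]
    rfl

/-- The function `∑ j, c j exp (-κ |t - x j|)` as an element of `H¹(ℝ)`. -/
noncomputable def expSum {n : ℕ} (x : Fin n → ℝ) {κ : ℝ} (hκ : 0 < κ) (c : Fin n → ℝ) : H1 :=
  ∑ j, (c j : ℂ) • expH1 hκ (x j)

lemma rep_expSum {n : ℕ} (x : Fin n → ℝ) {κ : ℝ} (hκ : 0 < κ) (c : Fin n → ℝ) (i : Fin n) :
    rep (expSum x hκ c) (x i) = ((expKernel x κ *ᵥ c) i : ℝ) := by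
  unfold expSum
  rw [rep_sum_smul]
  simp only [rep_expH1, mulVec, dotProduct, expKernel_apply, expDecay]
  push_cast
  exact Finset.sum_congr rfl fun j _ => mul_comm _ _

/-- The weak form of `(-Δ + μ + κ ^ 2) f` is a combination of point evaluations at the `x i`: the
kinks of the exponentials give `2 κ c i`, the measure gives `α i f (x i)`. The case `α = 0` is
summed first. -/
lemma form_expSum_add_inner {n : ℕ} (α x : Fin n → ℝ) {κ : ℝ} (hκ : 0 < κ) (c : Fin n → ℝ)
    (g : H1) :
    form (pointMeasure α x) (expSum x hκ c) g + κ ^ 2 * inner ℂ (g : L2) (expSum x hκ c : L2) =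
      ∑ i, ((2 * κ * c i + α i * (expKernel x κ *ᵥ c) i : ℝ) : ℂ) *
        starRingEnd ℂ (rep g (x i)) := by
  have h0 : form (pointMeasure 0 x) (expSum x hκ c) g +
      κ ^ 2 * inner ℂ (g : L2) (expSum x hκ c : L2) =
      ∑ j, (c j : ℂ) * (2 * κ * starRingEnd ℂ (rep g (x j))) := by
    unfold expSum
    rw [form_sum_smul_left, Submodule.coe_sum, inner_sum, Finset.mul_sum,
      ← Finset.sum_add_distrib]
    refine Finset.sum_congr rfl fun j _ => ?_
    rw [← integral_weakDeriv_expH1_add_inner g hκ (x j), form_pointMeasure, Submodule.coe_smul,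
      inner_smul_right]
    simp only [Pi.zero_apply, Complex.ofReal_zero, zero_mul, Finset.sum_const_zero, add_zero]
    ring
  rw [form_pointMeasure] at h0 ⊢
  simp only [Pi.zero_apply, Complex.ofReal_zero, zero_mul, Finset.sum_const_zero, add_zero] at h0
  rw [add_right_comm, h0, ← Finset.sum_add_distrib]
  refine Finset.sum_congr rfl fun i _ => ?_
  rw [rep_expSum]
  push_cast
  ring

/-- The exponential kernel is positive semidefinite. -/
lemma expKernel_nonneg {n : ℕ} (x : Fin n → ℝ) {κ : ℝ} (hκ : 0 < κ) (c : Fin n → ℝ) :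
    0 ≤ c ⬝ᵥ expKernel x κ *ᵥ c := by
  -- With `α = 0` and `g = f` the identity reads `2 κ cᵀ K c = ‖f'‖ ^ 2 + κ ^ 2 ‖f‖ ^ 2`.
  have h := form_expSum_add_inner 0 x hκ c (expSum x hκ c)
  rw [form_pointMeasure, inner_self_eq_norm_sq_to_K] at h
  simp only [Pi.zero_apply, Complex.ofReal_zero, zero_mul, Finset.sum_const_zero, add_zero,
    rep_expSum, Complex.mul_conj, Complex.conj_ofReal, integral_complex_ofReal] at h
  have h' : (∫ t, Complex.normSq ((weakDeriv (expSum x hκ c) : ℝ → ℂ) t)) +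
      κ ^ 2 * ‖(expSum x hκ c : L2)‖ ^ 2 = 2 * κ * (c ⬝ᵥ expKernel x κ *ᵥ c) := by
    rw [dotProduct, Finset.mul_sum]
    simp only [← mul_assoc]
    refine Complex.ofReal_injective (Eq.trans ?_ (h.trans ?_))
    · rw [Complex.ofReal_add, Complex.ofReal_mul, Complex.ofReal_pow, Complex.ofReal_pow]
      rfl
    · push_cast
      rfl
  refine nonneg_of_mul_nonneg_right (a := 2 * κ) ?_ (by positivity)
  rw [← h']
  exact add_nonneg (integral_nonneg fun t => Complex.normSq_nonneg _) (by positivity)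

/-- The values of the sum at the points `x i` form the vector `K c`, and `K` is injective. -/
lemma expSum_ne_zero {n : ℕ} {x : Fin n → ℝ} (hx : StrictMono x) {κ : ℝ} (hκ : 0 < κ)
    {c : Fin n → ℝ} (hc : c ≠ 0) : (expSum x hκ c : L2) ≠ 0 := by
  intro h
  have hf : expSum x hκ c = 0 := Subtype.ext h
  have hv : expKernel x κ *ᵥ c = 0 := by
    ext i
    have := rep_expSum x hκ c i
    rw [hf, ← zero_smul ℂ (0 : H1), rep_smul] at this
    simpa using this.symm
  refine hc (funext fun j => ?_)
  obtain ⟨d, hd, -⟩ := exists_mulVec_expKernel_eq_single hx hκ j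
  have := expKernel_dotProduct_comm x κ c d
  rw [hv, hd] at this
  simpa using this

/-- An eigenvector of the relation `schrodingerGraph` is an eigenvector of the operator. -/
lemma isEigenvalue_of_mem_graph {μ : SignedMeasure ℝ} {f : L2} {z : ℂ} (hf : f ≠ 0)
    (h : (f, z • f) ∈ schrodingerGraph μ) : IsEigenvalue (schrodinger μ) z := by
  rw [← schrodinger_graph, LinearPMap.mem_graph_iff] at h
  obtain ⟨y, hy, hT⟩ := h
  simp only at hy hT
  exact ⟨y, hy ▸ hf, hT.trans (by rw [hy])⟩

end DeltaSchrodinger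

theorem mainTheorem10 (n : ℕ) (α x : Fin n → ℝ) (hx : StrictMono x) (k : Fin n) (hk : α k < 0)
    (hd : 1 / DeltaSchrodinger.distLeft x k + 1 / DeltaSchrodinger.distRight x k
      < ((-α k : ℝ) : EReal)) :
    ∃ E : ℝ, E < 0 ∧ DeltaSchrodinger.IsEigenvalue
      (DeltaSchrodinger.schrodinger (DeltaSchrodinger.pointMeasure α x)) (E : ℂ) := by
  rw [DeltaSchrodinger.one_div_distLeft, DeltaSchrodinger.one_div_distRight, ← EReal.coe_add,
    EReal.coe_lt_coe_iff] at hd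
  obtain ⟨κ, hκ, c, hc, h⟩ := DeltaSchrodinger.exists_kernel_solution hx
    (fun κ hκ c => DeltaSchrodinger.expKernel_nonneg x hκ c) hd
  refine ⟨-κ ^ 2, neg_lt_zero.2 (by positivity), DeltaSchrodinger.isEigenvalue_of_mem_graph
    (DeltaSchrodinger.expSum_ne_zero hx hκ hc) ⟨DeltaSchrodinger.expSum x hκ c, rfl, fun g => ?_⟩⟩
  have := DeltaSchrodinger.form_expSum_add_inner α x hκ c g
  -- The system for `c` kills every point evaluation, leaving `a_μ(f, g) = -κ ^ 2 ⟨f, g⟩`.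
  simp only [h, Complex.ofReal_zero, zero_mul, Finset.sum_const_zero] at this
  rw [inner_smul_right, eq_neg_of_add_eq_zero_left this]
  push_cast
  ring
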